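/- **Lemma 3.1.** A *closed 2D discrete surface* $D$ is a finite polygonal cell complex without boundary, with vertices, edges and faces (for example a triangulated or a cubical one): every edge has exactly two end points and lies on exactly two faces, the boundary of every face is a simple closed polygon, and the edges and faces around every vertex form a single cycle. Call two cells *incident* if one is a face of the other or they are equal. A *path* in a set $S$ of cells is a finite sequence of cells of $S$ with consecutive cells incident; two paths are *homotopic in $S$* if they are related by finitely many elementary moves and their inverses, the moves being to replace three consecutive pairwise incident cells $a,b,c\in S$ by $a,c$, and to replace $a,a$ by $a$. The set $S$ is *connected* if any two of its cells are joined by a path in $S$ (so the empty set is connected), and *simply connected* if it is non-empty and connected and every closed path in $S$ is homotopic in $S$ to the constant path at its base point. A *partition* of $D$ is given by its edge network $\Gamma$, a set of edges and vertices of $D$ that contains both end points of each of its edges. Its *patches* are the connected components $U$ of $D\setminus\Gamma$. The *closed patch* $\overline U$ consists of the cells of $U$ and all their faces (of every dimension), and the *boundary* of $U$ is $\overline U\cap\Gamma$. Let $D$ be a simply connected closed 2D discrete surface, and let $\Gamma$ be the edge network of a partition of $D$ such that $\Gamma$ is connected. Then every patch $U$ is simply connected. Moreover, if the boundary of $U$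 is a (possibly empty) disjoint union of simple closed curves, that is, if exactly two boundary edges end at every boundary vertex, then the closed patch $\overline U$ is simply connected as well. -/

import Mathlib

/-! Finite cell complexes are described by their partially ordered set of (open) cells, where `a ≤ b`
means that the cell `a` is a face of the cell `b`.  A region is a set of cells. -/

namespace DiscreteSurface

section Regions

variable {C : Type*} [PartialOrder C]

/-- Two cells are incident if one of them is a face of the other (possibly both are equal). -/
def Incident (a b : C) : Prop := a ≤ b ∨ b ≤ a

/-- `a` and `b` can be joined by a path of successively incident cells of the region `S`. -/
def Linked (S : Set C) (a b : C) : Prop :=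
  Relation.ReflTransGen (fun x y => x ∈ S ∧ y ∈ S ∧ Incident x y) a b

/-- Any two cells of the region can be joined inside the region (the empty region is allowed). -/
def IsPreconnectedRegion (S : Set C) : Prop := ∀ a ∈ S, ∀ b ∈ S, Linked S a b

/-- A non-empty region in which any two cells can be joined. -/
def IsConnectedRegion (S : Set C) : Prop := S.Nonempty ∧ IsPreconnectedRegion S

/-- A path in the region `S`: a list of cells of `S`, consecutive ones being incident.  These are the
edge paths of the barycentric subdivision: a cell is represented by its barycentre. -/
def IsPathIn (S : Set C) (l : List C) : Prop := l.IsChain Incident ∧ ∀ x ∈ l, x ∈ S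

/-- The elementary deformations of paths in the region `S`: a detour `a, b, c` along a triangle
of the barycentric subdivision (three pairwise incident cells) is replaced by `a, c`, and a
repeated cell is written only once.  As `c = a` is allowed in the first rule, the two rules
together remove a backtracking `a, b, a`. -/
inductive ElementaryMove (S : Set C) : List C → List C → Prop
  | triangle (p q : List C) (a b c : C) (ha : a ∈ S) (hb : b ∈ S) (hc : c ∈ S)
      (hab : Incident a b) (hbc : Incident b c) (hac : Incident a c) :
      ElementaryMove S (p ++ a :: b :: c :: q) (p ++ a :: c :: q)
  | stutter (p q : List C) (a : C) (ha : a ∈ S) :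
      ElementaryMove S (p ++ a :: a :: q) (p ++ a :: q)

/-- Homotopy of paths with fixed end points in the region `S`: finitely many elementary
deformations and their inverses. -/
def HomotopicIn (S : Set C) : List C → List C → Prop := Relation.EqvGen (ElementaryMove S)

/-- A region is simply connected if it is non-empty and connected and every closed path in it
is contractible in it to the constant path at its base point. -/
def IsSimplyConnected (S : Set C) : Prop :=
  IsConnectedRegion S ∧
    ∀ (a : C) (l : List C), IsPathIn S (a :: (l ++ [a])) →
      HomotopicIn S (a :: (l ++ [a])) [a]

end Regions

/-- A closed 2D discrete surface on the set of cells `C`: a finite 2-dimensional polygonal cell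
complex without boundary (for example a triangulated or a cubical one).  Every edge has two end
points and lies on two faces, the boundary of every face is a simple closed polygon, and the
edges and faces around every vertex form a single cycle.  Connectedness is not part of the
definition. -/
structure ClosedSurface (C : Type*) [PartialOrder C] where
  finite : Finite C
  /-- The dimension of a cell: vertices, edges and faces have dimension 0, 1 and 2. -/
  dim : C → ℕ
  dim_le_two : ∀ c, dim c ≤ 2
  dim_strictMono : StrictMono dim
  edge_vertices : ∀ e, dim e = 1 → (Set.Iio e).ncard = 2
  edge_faces : ∀ e, dim e = 1 → (Set.Ioi e).ncard = 2
  /-- If `v` is a vertex of the face `f`, then exactly two edges of `f` end at `v`. -/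
  corner_edges : ∀ v f, dim v = 0 → dim f = 2 → v < f → (Set.Ioo v f).ncard = 2
  face_boundary_connected : ∀ f, dim f = 2 → IsConnectedRegion (Set.Iio f)
  vertex_star_connected : ∀ v, dim v = 0 → IsConnectedRegion (Set.Ioi v)

/-- A partition of a discrete surface is given by its edge network: a set of edges and vertices
of the surface that contains the end points of its edges.  The patches are the pieces into which
the network cuts the surface. -/
structure Partition {C : Type*} [PartialOrder C] (M : ClosedSurface C) where
  network : Set C
  isLowerSet : IsLowerSet network
  dim_le_one : ∀ c ∈ network, M.dim c ≤ 1

namespace Partition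

variable {C : Type*} [PartialOrder C] {M : ClosedSurface C}

/-- A patch (without its boundary) is a connected component of the complement of the network. -/
def IsPatch (P : Partition M) (U : Set C) : Prop :=
  ∃ x ∈ P.networkᶜ, U = {y | Linked P.networkᶜ x y}

/-- The closed patch: all cells of the patch together with all their faces. -/
def closedPatch (_P : Partition M) (U : Set C) : Set C := {c | ∃ d ∈ U, c ≤ d}

/-- The boundary of a patch: the part of the network that lies on the closed patch. -/
def patchBoundary (P : Partition M) (U : Set C) : Set C := P.closedPatch U ∩ P.network

/-- The boundary of the patch `U` is a disjoint union of simple closed curves (there may be none):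
exactly two boundary edges end at every boundary vertex. -/
def HasSimpleBoundary (P : Partition M) (U : Set C) : Prop :=
  ∀ v ∈ P.patchBoundary U, M.dim v = 0 → {e | e ∈ P.patchBoundary U ∧ v < e}.ncard = 2

end Partition

end DiscreteSurface

/-!
A region is simply connected as soon as it is connected and every group-valued cocycle on it is a
coboundary (the universal cover is then trivial), so everything is done with cocycles.  Let `T` be
a spanning tree of the network and `T'` a spanning tree of the surface that extends it.  Growing a
disc from a face across edges off `T'` exhausts the complement of `T'`: it reaches every face
because a tree carries no cycle mod 2, and every edge because the fundamental cycle of the edge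
bounds.  Adding the leaves of `T'` outside `T` one after the other shows that the complement of `T`
has only trivial cocycles.  Cutting along the remaining edges of the network does not change this,
because a cocycle on the cut surface extends by `1` over them.  Finally, a simple boundary can be
glued to its patch along connected links.
-/

namespace DiscreteSurface

section Regions

variable {C : Type*} [PartialOrder C] {S T : Set C} {a b x : C}

lemma Incident.refl (a : C) : Incident a a := Or.inl le_rfl

lemma Incident.symm (h : Incident a b) : Incident b a := Or.symm h

lemma Linked.symm (h : Linked S a b) : Linked S b a :=
  have : Std.Symm (fun x y : C => x ∈ S ∧ y ∈ S ∧ Incident x y) :=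
    ⟨fun _ _ h => ⟨h.2.1, h.1, h.2.2.symm⟩⟩
  Relation.ReflTransGen.stdSymm.symm _ _ h

lemma Linked.trans {c : C} (h : Linked S a b) (h' : Linked S b c) : Linked S a c :=
  Relation.ReflTransGen.trans h h'

lemma Linked.mono (hST : S ⊆ T) (h : Linked S a b) : Linked T a b :=
  Relation.ReflTransGen.mono (fun _ _ h => ⟨hST h.1, hST h.2.1, h.2.2⟩) _ _ h

lemma Linked.single (ha : a ∈ S) (hb : b ∈ S) (h : Incident a b) : Linked S a b :=
  Relation.ReflTransGen.single ⟨ha, hb, h⟩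

lemma Linked.induction {p : C → Prop} (h : Linked S a b) (ha : p a)
    (hp : ∀ x ∈ S, ∀ y ∈ S, Incident x y → p x → p y) : p b := by
  induction h with
  | refl => exact ha
  | tail _ h ih => exact hp _ h.1 _ h.2.1 h.2.2 ih

lemma Linked.mem (h : Linked S a b) (ha : a ∈ S) : b ∈ S :=
  h.induction ha fun _ _ _ hy _ _ => hy

lemma isConnectedRegion_of_linked (hx : x ∈ S) (h : ∀ a ∈ S, Linked S x a) :
    IsConnectedRegion S :=
  ⟨⟨x, hx⟩, fun a ha b hb => (h a ha).symm.trans (h b hb)⟩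

lemma isConnectedRegion_of_incident (hx : x ∈ S) (h : ∀ a ∈ S, Incident x a) :
    IsConnectedRegion S :=
  isConnectedRegion_of_linked hx fun a ha => .single hx ha (h a ha)

lemma IsPreconnectedRegion.insert (hS : IsPreconnectedRegion S) (ha : a ∈ S)
    (hax : Incident a x) : IsPreconnectedRegion (insert x S) := by
  refine (isConnectedRegion_of_linked (Set.mem_insert_of_mem _ ha) ?_).2
  rintro b (rfl | hb)
  · exact .single (Set.mem_insert_of_mem _ ha) (Set.mem_insert _ _) hax
  · exact (hS a ha b hb).mono (Set.subset_insert _ _)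

lemma IsPreconnectedRegion.induction_above {p Q : C → Prop} (hS : IsPreconnectedRegion S)
    (hQ : ∀ c ∈ S, ∃ f, c ≤ f ∧ Q f)
    (hp : ∀ c ∈ S, ∀ f f', Q f → Q f' → c ≤ f → c ≤ f' → p f → p f')
    (ha : a ∈ S) (hb : b ∈ S) (hQa : Q a) (hQb : Q b) (hpa : p a) : p b := by
  refine (hS a ha b hb).induction (p := fun c => ∀ f, Q f → c ≤ f → p f)
    (fun f hf haf => hp a ha a f hQa hf le_rfl haf hpa) ?_ b hQb le_rfl
  rintro x hx y hy (hxy | hyx) ih f hf hyf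
  · exact ih f hf (hxy.trans hyf)
  · obtain ⟨f₀, hxf₀, hf₀⟩ := hQ x hx
    exact hp y hy f₀ f hf₀ hf (hyx.trans hxf₀) hyf (ih f₀ hf₀ hxf₀)

lemma IsPreconnectedRegion.induction_below {p Q : C → Prop} (hS : IsPreconnectedRegion S)
    (hQ : ∀ c ∈ S, ∃ v, v ≤ c ∧ Q v)
    (hp : ∀ c ∈ S, ∀ v v', Q v → Q v' → v ≤ c → v' ≤ c → p v → p v')
    (ha : a ∈ S) (hb : b ∈ S) (hQa : Q a) (hQb : Q b) (hpa : p a) : p b := by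
  refine (hS a ha b hb).induction (p := fun c => ∀ v, Q v → v ≤ c → p v)
    (fun v hv hva => hp a ha a v hQa hv le_rfl hva hpa) ?_ b hQb le_rfl
  rintro x hx y hy (hxy | hyx) ih v hv hvy
  · obtain ⟨v₀, hv₀x, hv₀⟩ := hQ x hx
    exact hp y hy v₀ v hv₀ hv (hv₀x.trans hxy) hvy (ih v₀ hv₀ hv₀x)
  · exact ih v hv (hvy.trans hyx)

/-- The link of a cell `x` in a region `S`, for use with `x ∉ S`: the cells of `S` along which `x`
is attached when it is added to `S`. -/
def link (S : Set C) (x : C) : Set C := {a ∈ S | Incident a x}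

end Regions

section Potentials

variable {C : Type*} [PartialOrder C] {G : Type*} [Group G] {S : Set C} {w : C → C → G}

/-- A `G`-valued one-dimensional cocycle on the order complex of a region, given on all pairs of
incident cells; it is alternating because degenerate triples are included. -/
def IsCocycleOn (S : Set C) (w : C → C → G) : Prop :=
  ∀ a ∈ S, ∀ b ∈ S, ∀ c ∈ S, Incident a b → Incident b c → Incident a c →
    w a b * w b c = w a c

variable (G) in
/-- Every `G`-valued cocycle on the region is a coboundary, that is, every homomorphism from the
fundamental groupoid of the region to `G` is trivial up to a gauge transformation. -/
def HasPotentials (S : Set C) : Prop :=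
  ∀ w : C → C → G, IsCocycleOn S w →
    ∃ g : C → G, ∀ a ∈ S, ∀ b ∈ S, Incident a b → g a * w a b = g b

lemma IsCocycleOn.mono {T : Set C} (hw : IsCocycleOn T w) (hST : S ⊆ T) : IsCocycleOn S w :=
  fun a ha b hb c hc => hw a (hST ha) b (hST hb) c (hST hc)

lemma IsCocycleOn.apply_self (hw : IsCocycleOn S w) {a : C} (ha : a ∈ S) : w a a = 1 :=
  mul_eq_left.1 (hw a ha a ha a ha (.refl a) (.refl a) (.refl a))

lemma IsCocycleOn.mul_symm (hw : IsCocycleOn S w) {a b : C} (ha : a ∈ S) (hb : b ∈ S)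
    (hab : Incident a b) : w a b * w b a = 1 := by
  rw [hw a ha b hb a ha hab hab.symm (.refl a), hw.apply_self ha]

lemma IsCocycleOn.mul_eq_of_lt (hw : IsCocycleOn S w) {g : C → G}
    (hg : ∀ a ∈ S, ∀ b ∈ S, a < b → g a * w a b = g b) :
    ∀ a ∈ S, ∀ b ∈ S, Incident a b → g a * w a b = g b := by
  rintro a ha b hb hab
  rcases eq_or_ne a b with rfl | hne
  · rw [hw.apply_self ha, mul_one]
  · rcases hab with hle | hba
    · exact hg a ha b hb (hle.lt_of_ne hne)
    · rw [← hg b hb a ha (hba.lt_of_ne hne.symm), mul_assoc, hw.mul_symm hb ha (.inl hba),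
        mul_one]

lemma HasPotentials.exists_of_lt (hS : HasPotentials G S)
    (hw : ∀ a ∈ S, ∀ b ∈ S, ∀ c ∈ S, a < b → b < c → w a b * w b c = w a c) :
    ∃ g : C → G, ∀ a ∈ S, ∀ b ∈ S, a < b → g a * w a b = g b := by
  classical
  let w' : C → C → G := fun a b => if a < b then w a b else if b < a then (w b a)⁻¹ else 1
  have w'_of_lt {a b : C} (h : a < b) : w' a b = w a b := if_pos h
  have w'_symm (a b : C) : w' b a = (w' a b)⁻¹ := by
    by_cases h₁ : a < b
    · simp [w', h₁, h₁.not_gt]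
    · by_cases h₂ : b < a <;> simp [w', h₁, h₂]
  have w'_self (a : C) : w' a a = 1 := by simp [w']
  have hlt {a b c : C} (ha : a ∈ S) (hb : b ∈ S) (hc : c ∈ S) (hab : a ≤ b) (hbc : b ≤ c) :
      w' a b * w' b c = w' a c := by
    rcases hab.eq_or_lt with rfl | hab
    · rw [w'_self, one_mul]
    rcases hbc.eq_or_lt with rfl | hbc
    · rw [w'_self, mul_one]
    rw [w'_of_lt hab, w'_of_lt hbc, w'_of_lt (hab.trans hbc), hw a ha b hb c hc hab hbc]
  obtain ⟨g, hg⟩ := hS w' fun a ha b hb c hc hab hbc hac => by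
    rcases hab with hab | hab <;> rcases hbc with hbc | hbc
    · exact hlt ha hb hc hab hbc
    · rcases hac with hac | hac
      · rw [← hlt ha hc hb hac hbc, w'_symm c b, mul_inv_cancel_right]
      · rw [w'_symm c b, ← hlt hc ha hb hac hab, w'_symm c a, mul_inv_rev, mul_inv_cancel_left]
    · rcases hac with hac | hac
      · rw [← hlt hb ha hc hab hac, w'_symm b a, inv_mul_cancel_left]
      · rw [w'_symm b a, ← hlt hb hc ha hbc hac, w'_symm c a, mul_inv_rev, inv_mul_cancel_right]
    · rw [w'_symm b a, w'_symm c b, w'_symm c a, ← mul_inv_rev, hlt hc hb ha hbc hab]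
  exact ⟨g, fun a ha b hb hab => w'_of_lt hab ▸ hg a ha b hb (Or.inl hab.le)⟩

lemma HasPotentials.union {B : Set C} (hS : HasPotentials G S) (hB : IsAntichain (· ≤ ·) B)
    (hSB : Disjoint S B) (hl : ∀ x ∈ B, IsConnectedRegion (link S x)) :
    HasPotentials G (S ∪ B) := by
  classical
  intro w hw
  obtain ⟨g, hg⟩ := hS w (hw.mono Set.subset_union_left)
  choose! p hp using fun x hx => (hl x hx).1
  have hlink : ∀ x ∈ B, ∀ a ∈ link S x, g a * w a x = g (p x) * w (p x) x := by
    intro x hx a ha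
    refine ((hl x hx).2 (p x) (hp x hx) a ha).induction
      (p := fun a => g a * w a x = g (p x) * w (p x) x) rfl ?_
    rintro b ⟨hb, hbx⟩ c ⟨hc, hcx⟩ hbc h
    rw [← h, ← hg b hb c hc hbc, mul_assoc,
      hw b (Or.inl hb) c (Or.inl hc) x (Or.inr hx) hbc hcx hbx]
  have hnotMem : ∀ a ∈ S, a ∉ B := fun a ha => Set.disjoint_left.1 hSB ha
  refine ⟨fun x => if x ∈ B then g (p x) * w (p x) x else g x, ?_⟩
  rintro a (ha | ha) b (hb | hb) hab
  · simp only [hnotMem a ha, hnotMem b hb, if_false, hg a ha b hb hab]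
  · simp only [hnotMem a ha, hb, if_false, if_true, hlink b hb a ⟨ha, hab⟩]
  · simp only [ha, hnotMem b hb, if_false, if_true, ← hlink a ha b ⟨hb, hab.symm⟩, mul_assoc,
      hw.mul_symm (Or.inl hb) (Or.inr ha) hab.symm, mul_one]
  · have h : a = b := hab.elim (hB.eq ha hb) fun hba => (hB.eq hb ha hba).symm
    subst h
    simp only [hw.apply_self (Or.inr ha), mul_one]

lemma HasPotentials.insert {x : C} (hS : HasPotentials G S) (hx : x ∉ S)
    (hl : IsConnectedRegion (link S x)) : HasPotentials G (insert x S) := by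
  rw [← Set.union_singleton]
  exact hS.union (IsAntichain.singleton) (by simpa using hx) (by rintro _ rfl; exact hl)

lemma hasPotentials_singleton (x : C) : HasPotentials G {x} := by
  refine fun w hw => ⟨1, ?_⟩
  rintro _ rfl _ rfl -
  simp [hw.apply_self (Set.mem_singleton _)]

end Potentials

section Paths

variable {C : Type*} {G : Type*} [Group G] {w : C → C → G}

/-- The ordered product of the values of a cocycle along a path. -/
def pathProd (w : C → C → G) : List C → G
  | [] => 1
  | [_] => 1
  | a :: b :: l => w a b * pathProd w (b :: l)

lemma pathProd_append (w : C → C → G) (p q : List C) (a : C) :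
    pathProd w (p ++ a :: q) = pathProd w (p ++ [a]) * pathProd w (a :: q) := by
  induction p with
  | nil => simp [pathProd]
  | cons b p ih =>
    cases p with
    | nil => simp [pathProd]
    | cons c p => simpa [pathProd, mul_assoc] using ih

variable [PartialOrder C] {S : Set C}

lemma IsCocycleOn.pathProd_eq_of_homotopicIn (hw : IsCocycleOn S w) {l l' : List C}
    (h : HomotopicIn S l l') : pathProd w l = pathProd w l' := by
  induction h with
  | rel _ _ h =>
    cases h with
    | triangle p q a b c ha hb hc hab hbc hac =>
      rw [pathProd_append, pathProd_append w p (c :: q)]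
      simp only [pathProd, ← mul_assoc, ← hw a ha b hb c hc hab hbc hac]
    | stutter p q a ha =>
      rw [pathProd_append, pathProd_append w p q]
      simp only [pathProd, hw.apply_self ha, one_mul]
  | refl => rfl
  | symm _ _ _ ih => exact ih.symm
  | trans _ _ _ _ _ ih ih' => exact ih.trans ih'

lemma isPathIn_cons_cons {a b : C} {l : List C} :
    IsPathIn S (a :: b :: l) ↔ Incident a b ∧ a ∈ S ∧ IsPathIn S (b :: l) := by
  simp only [IsPathIn, List.isChain_cons_cons, List.forall_mem_cons]
  tauto

lemma IsPathIn.append {a b : C} {l m : List C} (hl : IsPathIn S (l ++ [a]))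
    (hm : IsPathIn S (b :: m)) (hab : Incident a b) : IsPathIn S (l ++ a :: b :: m) := by
  rw [List.append_cons]
  refine ⟨List.isChain_append.2 ⟨hl.1, hm.1, by simpa using hab⟩, fun x hx => ?_⟩
  exact (List.mem_append.1 hx).elim (hl.2 x) (hm.2 x)

lemma Linked.exists_path {a b : C} (h : Linked S a b) (ha : a ∈ S) :
    ∃ l : List C, IsPathIn S (a :: (l ++ [b])) := by
  refine h.induction (p := fun x => ∃ l : List C, IsPathIn S (a :: (l ++ [x])))
    ⟨[], by simp [IsPathIn, ha, Incident.refl]⟩ ?_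
  rintro x _ y hy hxy ⟨l, hl⟩
  refine ⟨l ++ [x], ?_⟩
  simpa using IsPathIn.append (l := a :: l) hl (m := []) ⟨by simp, by simpa using hy⟩ hxy

/-- The potential of `x` is the product of the cocycle along any path from a base point to `x`. -/
lemma IsSimplyConnected.hasPotentials (hS : IsSimplyConnected S) : HasPotentials G S := by
  intro w hw
  obtain ⟨⟨⟨o, ho⟩, hc⟩, hloop⟩ := hS
  choose! p hp using fun x (hx : x ∈ S) => (hc o ho x hx).exists_path ho
  choose! q hq using fun x (hx : x ∈ S) => (hc x hx o ho).exists_path hx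
  have hprod : ∀ x ∈ S, ∀ y ∈ S, Incident x y →
      pathProd w (o :: (p x ++ [x])) * w x y * pathProd w (y :: (q y ++ [o])) = 1 := by
    intro x hx y hy hxy
    have hpath : IsPathIn S (o :: ((p x ++ x :: y :: q y) ++ [o])) := by
      simpa using IsPathIn.append (l := o :: p x) (hp x hx) (hq y hy) hxy
    have h := hw.pathProd_eq_of_homotopicIn (hloop o _ hpath)
    have happend : o :: ((p x ++ x :: y :: q y) ++ [o]) =
        (o :: p x) ++ x :: (y :: (q y ++ [o])) := by simp
    rw [happend, pathProd_append] at h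
    simpa [pathProd, mul_assoc] using h
  refine ⟨fun x => pathProd w (o :: (p x ++ [x])), fun a ha b hb hab => ?_⟩
  have hb' := hprod b hb b hb (.refl b)
  rw [hw.apply_self hb, mul_one] at hb'
  exact mul_right_cancel ((hprod a ha b hb hab).trans hb'.symm)

end Paths

section UniversalCover

variable {C : Type*} [PartialOrder C] {S : Set C} {a b c o : C}

lemma ElementaryMove.append {l l' : List C} (h : ElementaryMove S l l') (u v : List C) :
    ElementaryMove S (u ++ l ++ v) (u ++ l' ++ v) := by
  cases h with
  | triangle p q a b c ha hb hc hab hbc hac =>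
    simpa using ElementaryMove.triangle (u ++ p) (q ++ v) a b c ha hb hc hab hbc hac
  | stutter p q a ha => simpa using ElementaryMove.stutter (u ++ p) (q ++ v) a ha

lemma HomotopicIn.append {l l' : List C} (h : HomotopicIn S l l') (u v : List C) :
    HomotopicIn S (u ++ l ++ v) (u ++ l' ++ v) := by
  induction h with
  | rel _ _ h => exact .rel _ _ (h.append u v)
  | refl => exact .refl _
  | symm _ _ _ ih => exact .symm _ _ ih
  | trans _ _ _ _ _ ih ih' => exact .trans _ _ _ ih ih'

/-- Homotopy as a congruence on the free monoid of all lists of cells. -/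
def pathCon (S : Set C) : Con (FreeMonoid C) where
  r l l' := HomotopicIn S l.toList l'.toList
  iseqv := Relation.EqvGen.is_equivalence _
  mul' {a b c d} h h' := by
    have h₁ := HomotopicIn.append h [] c.toList
    have h₂ := HomotopicIn.append h' b.toList []
    simp only [List.nil_append, List.append_nil] at h₁ h₂
    exact .trans _ _ _ h₁ h₂

/-- The homotopy class of a list of cells. -/
def pathClass (S : Set C) (l : List C) : (pathCon S).Quotient :=
  (FreeMonoid.ofList l : FreeMonoid C)

lemma pathClass_append (l l' : List C) :
    pathClass S (l ++ l') = pathClass S l * pathClass S l' := rfl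

lemma pathClass_eq_iff {l l' : List C} : pathClass S l = pathClass S l' ↔ HomotopicIn S l l' :=
  Con.eq _

lemma pathClass_stutter (ha : a ∈ S) :
    pathClass S [a] * pathClass S [a] = pathClass S [a] := by
  rw [← pathClass_append, pathClass_eq_iff]
  exact .rel _ _ (.stutter [] [] a ha)

lemma pathClass_triangle (ha : a ∈ S) (hb : b ∈ S) (hc : c ∈ S)
    (hab : Incident a b) (hbc : Incident b c) (hac : Incident a c) :
    pathClass S [a] * pathClass S [b] * pathClass S [c] = pathClass S [a] * pathClass S [c] := by
  rw [← pathClass_append, ← pathClass_append, ← pathClass_append, pathClass_eq_iff]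
  exact .rel _ _ (.triangle [] [] a b c ha hb hc hab hbc hac)

/-- The homotopy classes of lists that end at `a`.  The classes of paths starting at a base point
form the fibre of the universal cover over `a`; other lists do no harm. -/
def Fiber (S : Set C) (a : C) : Type _ :=
  {m : (pathCon S).Quotient // m * pathClass S [a] = m}

lemma Fiber.mul_mul (ha : a ∈ S) (hb : b ∈ S) (hc : c ∈ S) (hab : Incident a b)
    (hbc : Incident b c) (hac : Incident a c) (m : Fiber S a) :
    m.1 * pathClass S [b] * pathClass S [c] = m.1 * pathClass S [c] := by
  rw [← m.2, mul_assoc, mul_assoc, ← mul_assoc (pathClass S [a]),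
    pathClass_triangle ha hb hc hab hbc hac, mul_assoc]

/-- Lifting the step from `a` to `b` to the universal cover. -/
def Fiber.step (ha : a ∈ S) (hb : b ∈ S) (hab : Incident a b) : Fiber S a ≃ Fiber S b where
  toFun m := ⟨m.1 * pathClass S [b], by rw [mul_assoc, pathClass_stutter hb]⟩
  invFun m := ⟨m.1 * pathClass S [a], by rw [mul_assoc, pathClass_stutter ha]⟩
  left_inv m := Subtype.ext <| (m.mul_mul ha hb ha hab hab.symm (.refl a)).trans m.2
  right_inv m := Subtype.ext <| (m.mul_mul hb ha hb hab.symm hab (.refl b)).trans m.2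

lemma Fiber.step_step (ha : a ∈ S) (hb : b ∈ S) (hc : c ∈ S) (hab : Incident a b)
    (hbc : Incident b c) (hac : Incident a c) (m : Fiber S a) :
    step hb hc hbc (step ha hb hab m) = step ha hc hac m :=
  Subtype.ext (m.mul_mul ha hb hc hab hbc hac)

lemma Linked.nonempty_fiber_equiv (h : Linked S a b) : Nonempty (Fiber S a ≃ Fiber S b) :=
  h.induction (p := fun x => Nonempty (Fiber S a ≃ Fiber S x)) ⟨Equiv.refl _⟩
    fun _ hx _ hy hxy ⟨φ⟩ => ⟨φ.trans (Fiber.step hx hy hxy)⟩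

/-- Identifying all fibres with the one over `o` turns the universal cover into a cocycle with
values in permutations; a potential of it is a trivialisation of the cover. -/
lemma HasPotentials.exists_section (hS : IsPreconnectedRegion S) (ho : o ∈ S)
    (h : HasPotentials (Equiv.Perm (Fiber S o)) S) (m : Fiber S o) :
    ∃ s : ∀ a ∈ S, Fiber S a, s o ho = m ∧
      ∀ a (ha : a ∈ S) b (hb : b ∈ S) (hab : Incident a b),
        Fiber.step ha hb hab (s a ha) = s b hb := by
  classical
  have φ : ∀ a ∈ S, Fiber S a ≃ Fiber S o := fun a ha =>
    Classical.choice (hS a ha o ho).nonempty_fiber_equiv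
  let w : C → C → Equiv.Perm (Fiber S o) := fun a b =>
    if h : a ∈ S ∧ b ∈ S ∧ Incident b a then
      (φ b h.2.1).symm.trans ((Fiber.step h.2.1 h.1 h.2.2).trans (φ a h.1))
    else 1
  have w_apply {a b : C} (ha : a ∈ S) (hb : b ∈ S) (hba : Incident b a) (n : Fiber S o) :
      w a b n = φ a ha (Fiber.step hb ha hba ((φ b hb).symm n)) := by
    simp only [w, dif_pos (⟨ha, hb, hba⟩ : a ∈ S ∧ b ∈ S ∧ Incident b a), Equiv.trans_apply]
  have hw : IsCocycleOn S w := by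
    intro a ha b hb c hc hab hbc hac
    ext1 n
    rw [Equiv.Perm.mul_apply, w_apply ha hb hab.symm, w_apply hb hc hbc.symm,
      w_apply ha hc hac.symm, Equiv.symm_apply_apply,
      Fiber.step_step hc hb ha hbc.symm hab.symm hac.symm]
  obtain ⟨g, hg⟩ := h w hw
  refine ⟨fun a ha => (φ a ha).symm ((g a)⁻¹ (g o (φ o ho m))), by simp, ?_⟩
  intro a ha b hb hab
  rw [Equiv.eq_symm_apply, ← w_apply hb ha hab, ← hg b hb a ha hab.symm, mul_inv_rev,
    ← Equiv.Perm.mul_apply, mul_inv_cancel_left]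

lemma section_mul_pathClass {s : ∀ a ∈ S, Fiber S a}
    (hs : ∀ a (ha : a ∈ S) b (hb : b ∈ S) (hab : Incident a b),
      Fiber.step ha hb hab (s a ha) = s b hb) (l : List C) :
    ∀ a (ha : a ∈ S) b (hb : b ∈ S), IsPathIn S (a :: (l ++ [b])) →
      (s a ha).1 * pathClass S (l ++ [b]) = (s b hb).1 := by
  induction l with
  | nil =>
    intro a ha b hb hl
    exact congrArg Subtype.val (hs a ha b hb (isPathIn_cons_cons.1 hl).1)
  | cons c l ih =>
    intro a ha b hb hl
    obtain ⟨hac, -, hl⟩ := isPathIn_cons_cons.1 hl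
    have hc : c ∈ S := hl.2 c List.mem_cons_self
    calc (s a ha).1 * pathClass S (c :: (l ++ [b]))
        = (s a ha).1 * pathClass S [c] * pathClass S (l ++ [b]) :=
        (mul_assoc (s a ha).1 (pathClass S [c]) (pathClass S (l ++ [b]))).symm
      _ = (s c hc).1 * pathClass S (l ++ [b]) :=
        congrArg (·.1 * pathClass S (l ++ [b])) (hs a ha c hc hac)
      _ = (s b hb).1 := ih c hc b hb hl

lemma isSimplyConnected_of_hasPotentials (hc : IsConnectedRegion S)
    (h : ∀ o, HasPotentials (Equiv.Perm (Fiber S o)) S) : IsSimplyConnected S := by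
  refine ⟨hc, fun o l hl => ?_⟩
  have ho : o ∈ S := hl.2 o List.mem_cons_self
  obtain ⟨s, hso, hs⟩ :=
    (h o).exists_section hc.2 ho ⟨pathClass S [o], pathClass_stutter ho⟩
  have hlift := section_mul_pathClass hs l o ho o ho hl
  rw [hso] at hlift
  exact pathClass_eq_iff.1 hlift

end UniversalCover

namespace ClosedSurface

section Cells

variable {C : Type*} [PartialOrder C] (M : ClosedSurface C) {a b c e f f' u v : C}

lemma dim_eq_one_of_lt_of_lt (hab : a < b) (hbc : b < c) : M.dim b = 1 := by
  have h₁ := M.dim_strictMono hab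
  have h₂ := M.dim_strictMono hbc
  have h₃ := M.dim_le_two c
  omega

lemma dim_eq_zero_of_lt (he : M.dim e = 1) (h : v < e) : M.dim v = 0 := by
  have := M.dim_strictMono h
  omega

lemma dim_eq_two_of_lt (he : M.dim e = 1) (h : e < f) : M.dim f = 2 := by
  have h₁ := M.dim_strictMono h
  have h₂ := M.dim_le_two f
  omega

lemma isMin_of_dim_eq_zero (hv : M.dim v = 0) : IsMin v :=
  isMin_iff_forall_not_lt.2 fun _ h => by
    have := M.dim_strictMono h
    omega

lemma isMax_of_dim_eq_two (hf : M.dim f = 2) : IsMax f :=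
  isMax_iff_forall_not_lt.2 fun c h => by
    have h₁ := M.dim_strictMono h
    have h₂ := M.dim_le_two c
    omega

lemma isLowerSet_singleton (hv : M.dim v = 0) : IsLowerSet {v} := by
  rintro _ b hb rfl
  exact (M.isMin_of_dim_eq_zero hv).eq_of_le hb

lemma isAntichain_dim_eq {n : ℕ} : IsAntichain (· ≤ ·) {c | M.dim c = n} :=
  fun _ ha _ hb hne hab => (M.dim_strictMono (hab.lt_of_ne hne)).ne (Eq.trans ha hb.symm)

lemma exists_face_gt (he : M.dim e = 1) : ∃ f, e < f ∧ M.dim f = 2 := by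
  obtain ⟨f, hf⟩ : (Set.Ioi e).Nonempty :=
    Set.nonempty_of_ncard_ne_zero (by simp [M.edge_faces e he])
  exact ⟨f, hf, M.dim_eq_two_of_lt he hf⟩

lemma exists_vertex_lt (he : M.dim e = 1) : ∃ v, v < e ∧ M.dim v = 0 := by
  obtain ⟨v, hv⟩ : (Set.Iio e).Nonempty :=
    Set.nonempty_of_ncard_ne_zero (by simp [M.edge_vertices e he])
  exact ⟨v, hv, M.dim_eq_zero_of_lt he hv⟩

lemma exists_face_ge (c : C) : ∃ f, c ≤ f ∧ M.dim f = 2 := by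
  by_cases hc : M.dim c = 2
  · exact ⟨c, le_rfl, hc⟩
  obtain ⟨d, hcd⟩ : ∃ d, c < d := by
    have := M.dim_le_two c
    interval_cases h : M.dim c
    · exact (M.vertex_star_connected c h).1
    · exact (M.exists_face_gt h).imp fun _ => And.left
    · exact absurd rfl hc
  by_cases hd : M.dim d = 2
  · exact ⟨d, hcd.le, hd⟩
  have hd : M.dim d = 1 := by
    have h₁ := M.dim_strictMono hcd
    have h₂ := M.dim_le_two d
    omega
  obtain ⟨f, hdf, hf⟩ := M.exists_face_gt hd
  exact ⟨f, (hcd.trans hdf).le, hf⟩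

lemma exists_vertex_le (c : C) : ∃ v, v ≤ c ∧ M.dim v = 0 := by
  by_cases hc : M.dim c = 0
  · exact ⟨c, le_rfl, hc⟩
  obtain ⟨d, hdc⟩ : ∃ d, d < c := by
    have := M.dim_le_two c
    interval_cases h : M.dim c
    · exact absurd rfl hc
    · exact (M.exists_vertex_lt h).imp fun _ => And.left
    · exact (M.face_boundary_connected c h).1
  by_cases hd : M.dim d = 0
  · exact ⟨d, hdc.le, hd⟩
  have hd : M.dim d = 1 := by
    have h₁ := M.dim_strictMono hdc
    have h₂ := M.dim_le_two c
    omega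
  obtain ⟨v, hvd, hv⟩ := M.exists_vertex_lt hd
  exact ⟨v, (hvd.trans hdc).le, hv⟩

lemma Iio_eq_pair (he : M.dim e = 1) (hu : u < e) (hv : v < e) (huv : u ≠ v) :
    Set.Iio e = {u, v} :=
  (Set.eq_of_subset_of_ncard_le (by simp [Set.pair_subset_iff, hu, hv])
    (by rw [M.edge_vertices e he, Set.ncard_pair huv])
    (Set.finite_of_ncard_ne_zero (by simp [M.edge_vertices e he]))).symm

lemma Ioi_eq_pair (he : M.dim e = 1) (hf : e < f) (hf' : e < f') (hff' : f ≠ f') :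
    Set.Ioi e = {f, f'} :=
  (Set.eq_of_subset_of_ncard_le (by simp [Set.pair_subset_iff, hf, hf'])
    (by rw [M.edge_faces e he, Set.ncard_pair hff'])
    (Set.finite_of_ncard_ne_zero (by simp [M.edge_faces e he]))).symm

lemma Ioo_eq_pair (hv : M.dim v = 0) (hf : M.dim f = 2) (ha : a ∈ Set.Ioo v f)
    (hb : b ∈ Set.Ioo v f) (hab : a ≠ b) : Set.Ioo v f = {a, b} :=
  have hcard := M.corner_edges v f hv hf (ha.1.trans ha.2)
  (Set.eq_of_subset_of_ncard_le (Set.pair_subset_iff.2 ⟨ha, hb⟩)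
    (by rw [hcard, Set.ncard_pair hab]) (Set.finite_of_ncard_ne_zero (by simp [hcard]))).symm

lemma exists_edge_ge (hv : M.dim v = 0) (hc : v < c) : ∃ e, e ≤ c ∧ v < e ∧ M.dim e = 1 := by
  by_cases hc₁ : M.dim c = 1
  · exact ⟨c, le_rfl, hc, hc₁⟩
  have hc₂ : M.dim c = 2 := by
    have h₁ := M.dim_strictMono hc
    have h₂ := M.dim_le_two c
    omega
  obtain ⟨e, hve, hec⟩ : (Set.Ioo v c).Nonempty :=
    Set.nonempty_of_ncard_ne_zero (by simp [M.corner_edges v c hv hc₂ hc])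
  exact ⟨e, hec.le, hve, M.dim_eq_one_of_lt_of_lt hve hec⟩

end Cells

section Induction

variable {C : Type*} [PartialOrder C] (M : ClosedSurface C) {p : C → Prop} {f f' u v : C}

lemma star_face_induction (hv : M.dim v = 0)
    (hp : ∀ e, v < e → M.dim e = 1 → ∀ f f', e < f → e < f' → p f → p f')
    (hvf : v < f) (hvf' : v < f') (hf : M.dim f = 2) (hf' : M.dim f' = 2) (hpf : p f) : p f' := by
  refine (M.vertex_star_connected v hv).2.induction_above (fun c _ => M.exists_face_ge c) ?_
    hvf hvf' hf hf' hpf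
  intro c hc f f' hf hf' hcf hcf'
  rcases hcf.eq_or_lt with rfl | hcf
  · rw [(M.isMax_of_dim_eq_two hf).eq_of_le hcf']
    exact id
  · have hc₁ := M.dim_eq_one_of_lt_of_lt hc hcf
    exact hp c hc hc₁ f f' hcf (hcf'.lt_of_ne fun h => by subst h; omega)

lemma face_induction {U : Set C} (hU : IsUpperSet U) (hc : IsPreconnectedRegion U)
    (hp : ∀ e ∈ U, M.dim e = 1 → ∀ f f', e < f → e < f' → p f → p f')
    (hfU : f ∈ U) (hfU' : f' ∈ U) (hf : M.dim f = 2) (hf' : M.dim f' = 2) (hpf : p f) :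
    p f' := by
  refine hc.induction_above (fun c _ => M.exists_face_ge c) ?_ hfU hfU' hf hf' hpf
  intro c hcU f f' hf hf' hcf hcf'
  rcases hcf.eq_or_lt with rfl | hcf
  · rw [(M.isMax_of_dim_eq_two hf).eq_of_le hcf']
    exact id
  have hc₂ := M.dim_strictMono hcf
  have hcf' : c < f' := hcf'.lt_of_ne fun h => by subst h; omega
  rw [hf] at hc₂
  interval_cases hc : M.dim c
  · exact M.star_face_induction hc (fun e hce => hp e (hU hce.le hcU)) hcf hcf' hf hf'
  · exact hp c hcU hc f f' hcf hcf'

lemma face_vertex_induction (hf : M.dim f = 2)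
    (hp : ∀ e, e < f → M.dim e = 1 → ∀ u v, u < e → v < e → p u → p v)
    (huf : u < f) (hvf : v < f) (hu : M.dim u = 0) (hv : M.dim v = 0) (hpu : p u) : p v := by
  refine (M.face_boundary_connected f hf).2.induction_below (fun c _ => M.exists_vertex_le c) ?_
    huf hvf hu hv hpu
  intro c hc u v hu hv huc hvc
  rcases huc.eq_or_lt with rfl | huc
  · rw [(M.isMin_of_dim_eq_zero hu).eq_of_ge hvc]
    exact id
  · have hc₁ := M.dim_eq_one_of_lt_of_lt huc hc
    exact hp c hc hc₁ u v huc (hvc.lt_of_ne fun h => by subst h; omega)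

lemma vertex_induction {K : Set C} (hK : IsLowerSet K) (hc : IsPreconnectedRegion K)
    (hp : ∀ e ∈ K, M.dim e = 1 → ∀ u v, u < e → v < e → p u → p v)
    (huK : u ∈ K) (hvK : v ∈ K) (hu : M.dim u = 0) (hv : M.dim v = 0) (hpu : p u) : p v := by
  refine hc.induction_below (fun c _ => M.exists_vertex_le c) ?_ huK hvK hu hv hpu
  intro c hcK u v hu hv huc hvc
  rcases huc.eq_or_lt with rfl | huc
  · rw [(M.isMin_of_dim_eq_zero hu).eq_of_ge hvc]
    exact id
  have hc₁ := M.dim_strictMono huc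
  have hc₂ := M.dim_le_two c
  have hvc : v < c := hvc.lt_of_ne fun h => by subst h; omega
  rw [hu] at hc₁
  interval_cases hc : M.dim c
  · exact hp c hcK hc u v huc hvc
  · exact M.face_vertex_induction hc (fun e hec => hp e (hK hec.le hcK)) huc hvc hu hv

end Induction

section Chains

variable {C : Type*} [PartialOrder C] (M : ClosedSurface C) {e e' f f' v : C} {c d : C}

/-- The cells of the next dimension that have `c` as a face. -/
noncomputable def cofaces (c : C) : Finset C :=
  have := M.finite
  {d | c < d ∧ M.dim d = M.dim c + 1}.toFinite.toFinset

/-- The boundary mod 2 of a chain, computed in all dimensions at once: the value at a vertex only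
depends on the edges of the chain, the value at an edge only on its faces. -/
noncomputable def boundary : (C → ZMod 2) →ₗ[ZMod 2] (C → ZMod 2) :=
  LinearMap.pi fun c => ∑ d ∈ M.cofaces c, LinearMap.proj d

lemma mem_cofaces : d ∈ M.cofaces c ↔ c < d ∧ M.dim d = M.dim c + 1 := by
  simp [cofaces]

lemma mem_cofaces_vertex (hv : M.dim v = 0) : e ∈ M.cofaces v ↔ v < e ∧ M.dim e = 1 := by
  rw [mem_cofaces, hv]

lemma cofaces_edge [DecidableEq C] (he : M.dim e = 1) (hf : e < f) (hf' : e < f')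
    (hff' : f ≠ f') : M.cofaces e = {f, f'} := by
  ext d
  have hd : e < d ↔ d = f ∨ d = f' := Set.ext_iff.1 (M.Ioi_eq_pair he hf hf' hff') d
  rw [mem_cofaces, Finset.mem_insert, Finset.mem_singleton, ← hd, he]
  exact and_iff_left_of_imp (M.dim_eq_two_of_lt he)

lemma boundary_apply (g : C → ZMod 2) (c : C) : M.boundary g c = ∑ d ∈ M.cofaces c, g d := by
  simp [boundary]

lemma boundary_single [DecidableEq C] (d c : C) :
    M.boundary (Pi.single d 1) c = if d ∈ M.cofaces c then 1 else 0 := by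
  simp [boundary_apply, Pi.single_apply]

lemma boundary_edge_eq_add (he : M.dim e = 1) (hf : e < f) (hf' : e < f') (hff' : f ≠ f')
    (g : C → ZMod 2) : M.boundary g e = g f + g f' := by
  classical
  rw [boundary_apply, M.cofaces_edge he hf hf' hff', Finset.sum_pair hff']

lemma boundary_edge_eq_zero_iff (he : M.dim e = 1) (g : C → ZMod 2) :
    M.boundary g e = 0 ↔ ∀ f f', e < f → e < f' → g f = g f' := by
  constructor
  · intro h f f' hf hf'
    by_cases hff' : f = f'
    · rw [hff']
    · rwa [M.boundary_edge_eq_add he hf hf' hff', CharTwo.add_eq_zero] at h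
  · intro h
    obtain ⟨f, f', hff', hfaces⟩ := Set.ncard_eq_two.1 (M.edge_faces e he)
    have hf : e < f := hfaces.ge (Set.mem_insert _ _)
    have hf' : e < f' := hfaces.ge (Set.mem_insert_of_mem _ rfl)
    rw [M.boundary_edge_eq_add he hf hf' hff', h f f' hf hf', CharTwo.add_self_eq_zero]

lemma boundary_boundary (hv : M.dim v = 0) (g : C → ZMod 2) :
    M.boundary (M.boundary g) v = 0 := by
  have := M.finite
  simp only [boundary_apply]
  rw [Finset.sum_comm' (s' := fun f => (Set.Ioo v f).toFinite.toFinset)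
    (t' := {f | v < f ∧ M.dim f = 2}.toFinite.toFinset)]
  · refine Finset.sum_eq_zero fun f hf => ?_
    obtain ⟨hvf, hf⟩ := (Set.Finite.mem_toFinset _).1 hf
    rw [Finset.sum_const, ← Set.ncard_eq_toFinset_card, M.corner_edges v f hv hf hvf,
      CharTwo.two_nsmul]
  · intro e f
    simp only [mem_cofaces, Set.Finite.mem_toFinset, Set.mem_Ioo, Set.mem_ofPred_eq, hv, zero_add]
    constructor
    · rintro ⟨⟨hve, he⟩, hef, -⟩
      exact ⟨⟨hve, hef⟩, hve.trans hef, M.dim_eq_two_of_lt he hef⟩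
    · rintro ⟨⟨hve, hef⟩, -, hf⟩
      have he := M.dim_eq_one_of_lt_of_lt hve hef
      exact ⟨⟨hve, he⟩, hef, by omega⟩

lemma eq_of_boundary_eq_zero {U : Set C} (hU : IsUpperSet U) (hc : IsPreconnectedRegion U)
    {g : C → ZMod 2} (hg : ∀ e ∈ U, M.dim e = 1 → M.boundary g e = 0)
    (hfU : f ∈ U) (hfU' : f' ∈ U) (hf : M.dim f = 2) (hf' : M.dim f' = 2) : g f = g f' :=
  M.face_induction (p := fun f' => g f = g f') hU hc
    (fun e heU he f f' hef hef' h =>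
      h.trans ((M.boundary_edge_eq_zero_iff he g).1 (hg e heU he) f f' hef hef'))
    hfU hfU' hf hf' rfl

/-- The number of changes of `p` around the vertex is even, so there cannot be a single one. -/
lemma star_face_induction_of_ne {p : C → Prop} {e₀ : C} (hv : M.dim v = 0)
    (hp : ∀ e, v < e → M.dim e = 1 → e ≠ e₀ → ∀ f f', e < f → e < f' → p f → p f')
    (hvf : v < f) (hvf' : v < f') (hf : M.dim f = 2) (hf' : M.dim f' = 2) (hpf : p f) : p f' := by
  classical
  let g : C → ZMod 2 := fun f => if p f then 1 else 0
  have hg : ∀ e, v < e → M.dim e = 1 → e ≠ e₀ → M.boundary g e = 0 := by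
    intro e hve he hne
    rw [M.boundary_edge_eq_zero_iff he]
    intro f f' hef hef'
    have : p f ↔ p f' := ⟨hp e hve he hne f f' hef hef', hp e hve he hne f' f hef' hef⟩
    simp only [g, this]
  have hg₀ : v < e₀ → M.dim e₀ = 1 → M.boundary g e₀ = 0 := by
    intro hve₀ he₀
    rw [← M.boundary_boundary hv g, boundary_apply M _ v]
    refine (Finset.sum_eq_single_of_mem e₀ ((M.mem_cofaces_vertex hv).2 ⟨hve₀, he₀⟩)
      fun e he hne => ?_).symm
    obtain ⟨hve, he⟩ := (M.mem_cofaces_vertex hv).1 he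
    exact hg e hve he hne
  refine M.star_face_induction hv (fun e hve he f f' hef hef' hpf => ?_) hvf hvf' hf hf' hpf
  have hge : M.boundary g e = 0 := by
    by_cases hne : e = e₀
    · subst hne
      exact hg₀ hve he
    · exact hg e hve he hne
  have := (M.boundary_edge_eq_zero_iff he g).1 hge f f' hef hef'
  by_contra hpf'
  simp [g, hpf, hpf'] at this

lemma boundary_single_face [DecidableEq C] (hv : M.dim v = 0) (hf : M.dim f = 2)
    (he : e ∈ Set.Ioo v f) (he' : e' ∈ Set.Ioo v f) (hne : e ≠ e') {x : C} (hx : x ∈ M.cofaces v) :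
    M.boundary (Pi.single f 1) x = (Pi.single e 1 + Pi.single e' 1 : C → ZMod 2) x := by
  obtain ⟨hvx, hx⟩ := (M.mem_cofaces_vertex hv).1 hx
  have hfx : f ∈ M.cofaces x ↔ x = e ∨ x = e' := by
    simpa [mem_cofaces, hvx, hx, hf] using Set.ext_iff.1 (M.Ioo_eq_pair hv hf he he' hne) x
  simp only [boundary_single, hfx]
  by_cases hxe : x = e
  · simp [hxe, hne]
  · simp [hxe, Pi.single_apply]

lemma exists_boundary_eq_single_add_single [DecidableEq C] (hv : M.dim v = 0)
    (he : e ∈ M.cofaces v) (he' : e' ∈ M.cofaces v) :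
    ∃ g : C → ZMod 2, ∀ x ∈ M.cofaces v,
      M.boundary g x = (Pi.single e 1 + Pi.single e' 1 : C → ZMod 2) x := by
  refine (M.vertex_star_connected v hv).2.induction_below
    (p := fun e' => ∃ g : C → ZMod 2, ∀ x ∈ M.cofaces v,
      M.boundary g x = (Pi.single e 1 + Pi.single e' 1 : C → ZMod 2) x)
    (Q := (· ∈ M.cofaces v)) (fun c hc => ?_) ?_ (M.mem_cofaces.1 he).1 (M.mem_cofaces.1 he').1
    he he' ⟨0, by simp [CharTwo.add_self_eq_zero]⟩
  · simpa only [M.mem_cofaces_vertex hv] using M.exists_edge_ge hv hc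
  rintro f - a b ha hb haf hbf ⟨g, hg⟩
  by_cases hab : a = b
  · exact ⟨g, hab ▸ hg⟩
  rw [M.mem_cofaces_vertex hv] at ha hb
  have hf : M.dim f = 2 := by
    rcases haf.eq_or_lt with rfl | haf
    · exact M.dim_eq_two_of_lt hb.2 (hbf.lt_of_ne (Ne.symm hab))
    · exact M.dim_eq_two_of_lt ha.2 haf
  have haf : a < f := haf.lt_of_ne fun h => by subst h; omega
  have hbf : b < f := hbf.lt_of_ne fun h => by subst h; omega
  refine ⟨g + Pi.single f 1, fun x hx => ?_⟩
  rw [map_add, Pi.add_apply, hg x hx,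
    M.boundary_single_face hv hf ⟨ha.1, haf⟩ ⟨hb.1, hbf⟩ hab hx]
  simp only [Pi.add_apply]
  linear_combination CharTwo.add_self_eq_zero ((Pi.single a 1 : C → ZMod 2) x)

lemma exists_boundary_eq_on_star (hv : M.dim v = 0) {ω : C → ZMod 2}
    (hω : M.boundary ω v = 0) :
    ∃ g : C → ZMod 2, ∀ e ∈ M.cofaces v, M.boundary g e = ω e := by
  classical
  obtain hempty | ⟨e₀, he₀⟩ := (M.cofaces v).eq_empty_or_nonempty
  · exact ⟨0, by simp [hempty]⟩
  choose! g hg using fun e (he : e ∈ M.cofaces v) =>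
    M.exists_boundary_eq_single_add_single hv he he₀
  refine ⟨∑ e ∈ M.cofaces v, ω e • g e, fun x hx => ?_⟩
  calc M.boundary (∑ e ∈ M.cofaces v, ω e • g e) x
      = ∑ e ∈ M.cofaces v, ω e * (Pi.single e 1 + Pi.single e₀ 1 : C → ZMod 2) x := by
        rw [map_sum, Finset.sum_apply]
        refine Finset.sum_congr rfl fun e he => ?_
        rw [map_smul, Pi.smul_apply, hg e he x hx, smul_eq_mul]
    _ = (∑ e ∈ M.cofaces v, ω e * (Pi.single e 1 : C → ZMod 2) x) +
          (∑ e ∈ M.cofaces v, ω e) * (Pi.single e₀ 1 : C → ZMod 2) x := by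
        simp only [Pi.add_apply, mul_add, Finset.sum_add_distrib, Finset.sum_mul]
    _ = ω x := by
        simp [← boundary_apply, hω, Pi.single_apply, hx]

/-- A choice of local fillings around the vertices and of one side of each edge turns the cycle
into a cocycle whose potential is a global filling. -/
lemma exists_boundary_eq (hM : HasPotentials (Multiplicative (ZMod 2)) (Set.univ : Set C))
    {ω : C → ZMod 2} (hω : ∀ v, M.dim v = 0 → M.boundary ω v = 0) :
    ∃ g : C → ZMod 2, ∀ e, M.dim e = 1 → M.boundary g e = ω e := by
  classical
  choose! γ hγ using fun v (hv : M.dim v = 0) => M.exists_boundary_eq_on_star hv (hω v hv)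
  choose φ hφ hφdim using M.exists_face_ge
  have hφ_edge : ∀ e, M.dim e = 1 → e < φ e := fun e he =>
    (hφ e).lt_of_ne fun h => by have := hφdim e; rw [← h] at this; omega
  let w : C → C → ZMod 2 := fun a b =>
    if M.dim a = 0 then γ a (φ b) else if b = φ a then 0 else ω a
  have hw : ∀ a b c, a < b → b < c → w a b + w b c = w a c := by
    intro v e f hve hef
    have he := M.dim_eq_one_of_lt_of_lt hve hef
    have hv := M.dim_eq_zero_of_lt he hve
    have hφf : φ f = f :=
      ((M.isMax_of_dim_eq_two (M.dim_eq_two_of_lt he hef)).eq_of_le (hφ f)).symm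
    simp only [w, hv, he, if_true, one_ne_zero, if_false, hφf]
    split_ifs with h
    · rw [h, add_zero]
    · rw [← hγ v hv e ((M.mem_cofaces_vertex hv).2 ⟨hve, he⟩),
        M.boundary_edge_eq_add he (hφ_edge e he) hef (Ne.symm h), ← add_assoc,
        CharTwo.add_self_eq_zero, zero_add]
  obtain ⟨g, hg⟩ := hM.exists_of_lt (w := fun a b => Multiplicative.ofAdd (w a b))
    fun a _ b _ c _ hab hbc => congrArg Multiplicative.ofAdd (hw a b c hab hbc)
  have hside : ∀ e f, e < f → (g f).toAdd = (g e).toAdd + w e f := fun e f hef =>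
    congrArg Multiplicative.toAdd (hg e trivial f trivial hef).symm
  refine ⟨fun c => (g c).toAdd, fun e he => ?_⟩
  obtain ⟨f, hef, hf⟩ := Set.exists_ne_of_one_lt_ncard (s := Set.Ioi e)
    (by simp [M.edge_faces e he]) (φ e)
  rw [M.boundary_edge_eq_add he hef (hφ_edge e he) hf, hside e f hef, hside e _ (hφ_edge e he)]
  simp only [w, he, one_ne_zero, if_false, hf, if_true]
  linear_combination CharTwo.add_self_eq_zero (g e).toAdd

end Chains

section Trees

variable {C : Type*} [PartialOrder C] {M : ClosedSurface C} {B K T U : Set C}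
  {e o u v : C}

/-- `T` is obtained from `B` by successively attaching edges, each at one end point, the other end
point being new: relative trees grown from `B`. -/
inductive TreeGrowth (M : ClosedSurface C) (B : Set C) : Set C → Prop
  | refl : TreeGrowth M B B
  | step {T : Set C} {e u v : C} (hT : TreeGrowth M B T) (he : M.dim e = 1) (hu : u < e)
      (hv : v < e) (huT : u ∈ T) (hvT : v ∉ T) : TreeGrowth M B (insert e (insert v T))

namespace TreeGrowth

lemma trans (hT : M.TreeGrowth B T) (hU : M.TreeGrowth T U) : M.TreeGrowth B U := by
  induction hU with
  | refl => exact hT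
  | step _ he hu hv huT hvT ih => exact ih.step he hu hv huT hvT

lemma subset (h : M.TreeGrowth B T) : B ⊆ T := by
  induction h with
  | refl => exact subset_rfl
  | step _ _ _ _ _ _ ih =>
    exact ih.trans ((Set.subset_insert _ _).trans (Set.subset_insert _ _))

lemma isLowerSet (h : M.TreeGrowth B T) (hB : IsLowerSet B) : IsLowerSet T := by
  induction h with
  | refl => exact hB
  | @step T e u v _ he hu hv huT hvT ih =>
    rintro x y hyx (rfl | rfl | hx)
    · rcases hyx.eq_or_lt with rfl | hyx
      · exact .inl rfl
      · rcases (M.Iio_eq_pair he hu hv (ne_of_mem_of_not_mem huT hvT)).le hyx with rfl | rfl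
        · exact .inr (.inr huT)
        · exact .inr (.inl rfl)
    · exact .inr (.inl ((M.isMin_of_dim_eq_zero (M.dim_eq_zero_of_lt he hv)).eq_of_le hyx))
    · exact .inr (.inr (ih hyx hx))

lemma dim_le_one (h : M.TreeGrowth B T) (hB : ∀ c ∈ B, M.dim c ≤ 1) : ∀ c ∈ T, M.dim c ≤ 1 := by
  induction h with
  | refl => exact hB
  | step _ he _ hv _ _ ih =>
    rintro c (rfl | rfl | hc)
    · exact he.le
    · exact (M.dim_eq_zero_of_lt he hv).le.trans zero_le_one
    · exact ih c hc

lemma eq_zero_of_boundary_eq_zero (h : M.TreeGrowth B T) (hB : IsLowerSet B) {ω : C → ZMod 2}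
    (hω : ∀ v, M.dim v = 0 → v ∉ B → M.boundary ω v = 0)
    (hT : ∀ e, M.dim e = 1 → e ∉ T → ω e = 0) : ∀ e, M.dim e = 1 → e ∉ B → ω e = 0 := by
  induction h with
  | refl => exact hT
  | @step T e u v h he _ hv _ hvT ih =>
    have hv₀ := M.dim_eq_zero_of_lt he hv
    have hleaf : M.boundary ω v = ω e := by
      rw [boundary_apply]
      refine Finset.sum_eq_single_of_mem e ((M.mem_cofaces_vertex hv₀).2 ⟨hv, he⟩)
        fun e' he' hne => ?_
      obtain ⟨hve', he'⟩ := (M.mem_cofaces_vertex hv₀).1 he'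
      refine hT e' he' ?_
      rintro (rfl | rfl | he'T)
      · exact hne rfl
      · exact hve'.false
      · exact hvT (h.isLowerSet hB hve'.le he'T)
    have hωe : ω e = 0 := hleaf ▸ hω v hv₀ fun hvB => hvT (h.subset hvB)
    refine ih fun e' he' he'T => ?_
    by_cases hne : e' = e
    · rw [hne, hωe]
    · refine hT e' he' ?_
      rintro (rfl | rfl | he'T')
      · exact hne rfl
      · omega
      · exact he'T he'T'

end TreeGrowth

lemma exists_spanning_treeGrowth (hBK : B ⊆ K) (hK : IsLowerSet K) (hc : IsPreconnectedRegion K)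
    (hoB : o ∈ B) (ho : M.dim o = 0) :
    ∃ T, M.TreeGrowth B T ∧ T ⊆ K ∧ ∀ v ∈ K, M.dim v = 0 → v ∈ T := by
  have := M.finite
  obtain ⟨T, -, hT⟩ := Finite.exists_le_maximal (a := B)
    (p := fun T => M.TreeGrowth B T ∧ T ⊆ K) ⟨.refl, hBK⟩
  obtain ⟨hBT, hTK⟩ := hT.prop
  refine ⟨T, hBT, hTK, fun v hvK hv => ?_⟩
  refine M.vertex_induction hK hc (fun e heK he u v hu hv huT => ?_) (hBK hoB) hvK ho hv
    (hBT.subset hoB)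
  by_contra hvT
  have hle : insert e (insert v T) ≤ T :=
    hT.le_of_ge ⟨hBT.step he hu hv huT hvT,
      Set.insert_subset heK (Set.insert_subset (hK hv.le heK) hTK)⟩
      ((Set.subset_insert _ _).trans (Set.subset_insert _ _))
  exact hvT (hle (Set.mem_insert_of_mem _ (Set.mem_insert _ _)))

lemma boundary_single_edge [DecidableEq C] (he : M.dim e = 1) (hu : u < e) (hv : v < e)
    (huv : u ≠ v) {x : C} (hx : M.dim x = 0) :
    M.boundary (Pi.single e 1) x = (Pi.single u 1 + Pi.single v 1 : C → ZMod 2) x := by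
  have hxe : e ∈ M.cofaces x ↔ x = u ∨ x = v := by
    rw [M.mem_cofaces_vertex hx, and_iff_left he]
    exact Set.ext_iff.1 (M.Iio_eq_pair he hu hv huv) x
  simp only [boundary_single, hxe]
  by_cases hxu : x = u
  · simp [hxu, huv]
  · simp [hxu, Pi.single_apply]

namespace TreeGrowth

lemma exists_boundary_eq_single_add_single [DecidableEq C] (h : M.TreeGrowth {o} T) :
    ∀ v ∈ T, M.dim v = 0 → ∃ ω : C → ZMod 2, (∀ x ∉ T, ω x = 0) ∧
      ∀ x, M.dim x = 0 → M.boundary ω x = (Pi.single v 1 + Pi.single o 1 : C → ZMod 2) x := by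
  induction h with
  | refl =>
    rintro _ rfl -
    exact ⟨0, by simp [CharTwo.add_self_eq_zero]⟩
  | @step T e u v _ he hu hv huT hvT ih =>
    rintro x (rfl | rfl | hxT) hx
    · omega
    · obtain ⟨ω, hωT, hω⟩ := ih u huT (M.dim_eq_zero_of_lt he hu)
      refine ⟨ω + Pi.single e 1, fun y hy => ?_, fun y hy => ?_⟩
      · have hye : y ≠ e := fun h => hy (.inl h)
        simp [hωT y fun h => hy (.inr (.inr h)), hye]
      · rw [map_add, Pi.add_apply, hω y hy,
          boundary_single_edge he hu hv (ne_of_mem_of_not_mem huT hvT) hy]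
        simp only [Pi.add_apply]
        linear_combination CharTwo.add_self_eq_zero ((Pi.single u 1 : C → ZMod 2) y)
    · obtain ⟨ω, hωT, hω⟩ := ih x hxT hx
      exact ⟨ω, fun y hy => hωT y fun h => hy (.inr (.inr h)), hω⟩

lemma exists_fundamental_cycle (h : M.TreeGrowth {o} T) (hT : ∀ v, M.dim v = 0 → v ∈ T)
    (he : M.dim e = 1) (heT : e ∉ T) :
    ∃ ω : C → ZMod 2, ω e = 1 ∧ (∀ x ∉ T, x ≠ e → ω x = 0) ∧
      ∀ v, M.dim v = 0 → M.boundary ω v = 0 := by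
  classical
  obtain ⟨u, v, huv, hends⟩ := Set.ncard_eq_two.1 (M.edge_vertices e he)
  have hu : u < e := hends.ge (Set.mem_insert _ _)
  have hv : v < e := hends.ge (Set.mem_insert_of_mem _ rfl)
  have hu₀ := M.dim_eq_zero_of_lt he hu
  have hv₀ := M.dim_eq_zero_of_lt he hv
  obtain ⟨ωu, hωuT, hωu⟩ := h.exists_boundary_eq_single_add_single u (hT u hu₀) hu₀
  obtain ⟨ωv, hωvT, hωv⟩ := h.exists_boundary_eq_single_add_single v (hT v hv₀) hv₀
  refine ⟨ωu + ωv + Pi.single e 1, by simp [hωuT e heT, hωvT e heT],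
    fun x hx hxe => by simp [hωuT x hx, hωvT x hx, hxe], fun x hx => ?_⟩
  simp only [map_add, Pi.add_apply, hωu x hx, hωv x hx, boundary_single_edge he hu hv huv hx]
  linear_combination CharTwo.add_self_eq_zero ((Pi.single u 1 : C → ZMod 2) x) +
    CharTwo.add_self_eq_zero ((Pi.single v 1 : C → ZMod 2) x) +
    CharTwo.add_self_eq_zero ((Pi.single o 1 : C → ZMod 2) x)

end TreeGrowth

lemma isConnectedRegion_star_diff (hv : M.dim v = 0) (he : M.dim e = 1) :
    IsConnectedRegion (Set.Ioi v \ {e}) := by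
  have hmem : ∀ f, v < f → M.dim f = 2 → f ∈ Set.Ioi v \ {e} := fun f hvf hf =>
    ⟨hvf, by rintro rfl; omega⟩
  have hface : ∀ c, v < c → ∃ f, c ≤ f ∧ v < f ∧ M.dim f = 2 := fun c hvc => by
    obtain ⟨f, hcf, hf⟩ := M.exists_face_ge c
    exact ⟨f, hcf, hvc.trans_le hcf, hf⟩
  obtain ⟨c, hvc⟩ := (M.vertex_star_connected v hv).1
  obtain ⟨f₀, -, hvf₀, hf₀⟩ := hface c hvc
  refine isConnectedRegion_of_linked (hmem f₀ hvf₀ hf₀) fun a ha => ?_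
  obtain ⟨f, haf, hvf, hf⟩ := hface a ha.1
  refine Linked.trans ?_ (Linked.single (hmem f hvf hf) ha (.inr haf))
  refine M.star_face_induction_of_ne (e₀ := e) (p := Linked (Set.Ioi v \ {e}) f₀) hv
    (fun e' hve' he' hne f f' hf hf' hlinked => ?_) hvf₀ hvf hf₀ hf .refl
  have hmem_of_lt : ∀ {f}, e' < f → f ∈ Set.Ioi v \ {e} := fun h =>
    hmem _ (hve'.trans h) (M.dim_eq_two_of_lt he' h)
  have he'S : e' ∈ Set.Ioi v \ {e} := ⟨hve', hne⟩
  exact (hlinked.trans (.single (hmem_of_lt hf) he'S (.inr hf.le))).trans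
    (.single he'S (hmem_of_lt hf') (.inl hf'.le))

variable {G : Type*} [Group G]

lemma hasPotentials_compl_of_leaf (hT : IsLowerSet T) (he : M.dim e = 1) (hu : u < e)
    (hv : v < e) (huT : u ∈ T) (hvT : v ∉ T)
    (h : HasPotentials G (insert e (insert v T))ᶜ) : HasPotentials G Tᶜ := by
  set S := (insert e (insert v T))ᶜ with hS
  have hv₀ := M.dim_eq_zero_of_lt he hv
  have heT : e ∉ T := fun heT => hvT (hT hv.le heT)
  have hlink_v : link S v = Set.Ioi v \ {e} := by
    ext a
    constructor
    · rintro ⟨ha, hav⟩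
      have hne : a ≠ v := fun h => ha (.inr (.inl h))
      refine ⟨(hav.resolve_left fun h => hne ?_).lt_of_ne hne.symm, fun h => ha (.inl h)⟩
      exact (M.isMin_of_dim_eq_zero hv₀).eq_of_le h
    · rintro ⟨hva, hae⟩
      refine ⟨?_, .inr hva.le⟩
      rintro (rfl | rfl | haT)
      · exact hae rfl
      · exact hva.false
      · exact hvT (hT hva.le haT)
  have hlink_e : IsConnectedRegion (link (insert v S) e) := by
    refine isConnectedRegion_of_incident (x := v) ⟨.inl rfl, .inl hv.le⟩ ?_
    rintro a ⟨rfl | ha, hae⟩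
    · exact .refl _
    rcases hae with hae | hae
    · have hne : a ≠ e := fun h => ha (.inl h)
      rcases (M.Iio_eq_pair he hu hv (ne_of_mem_of_not_mem huT hvT)).le (hae.lt_of_ne hne)
        with rfl | rfl
      · exact absurd (.inr (.inr huT)) ha
      · exact .refl _
    · exact .inl (hv.le.trans hae)
  have hTS : Tᶜ = insert e (insert v S) := by
    ext x
    by_cases hxe : x = e <;> by_cases hxv : x = v <;> simp_all
  rw [hTS]
  refine (h.insert (fun h => h (.inr (.inl rfl))) ?_).insert ?_ hlink_e
  · rw [hlink_v]
    exact isConnectedRegion_star_diff hv₀ he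
  · rintro (rfl | h)
    · exact hv.false
    · exact h (.inl rfl)

lemma TreeGrowth.hasPotentials_compl (h : M.TreeGrowth B T) (hB : IsLowerSet B)
    (hT : HasPotentials G Tᶜ) : HasPotentials G Bᶜ := by
  induction h with
  | refl => exact hT
  | step h he hu hv huT hvT ih =>
    exact ih (hasPotentials_compl_of_leaf (h.isLowerSet hB) he hu hv huT hvT hT)

end Trees

section Discs

variable {C : Type*} [PartialOrder C] {M : ClosedSurface C} {D T : Set C} {e f f' o : C}
  {G : Type*} [Group G]

/-- Open discs: starting from a face, further faces are successively glued on, each along a single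
edge, and that edge is included. -/
inductive IsDisc (M : ClosedSurface C) : Set C → Prop
  | face {f : C} (hf : M.dim f = 2) : IsDisc M {f}
  | glue {D : Set C} {e f f' : C} (hD : IsDisc M D) (he : M.dim e = 1) (hf : e < f) (hf' : e < f')
      (hfD : f ∈ D) (hfD' : f' ∉ D) : IsDisc M (insert f' (insert e D))

namespace IsDisc

lemma isUpperSet (h : M.IsDisc D) : IsUpperSet D := by
  induction h with
  | face hf =>
    rintro x y hxy rfl
    exact ((M.isMax_of_dim_eq_two hf).eq_of_le hxy).symm
  | @glue D e f f' _ he hf hf' hfD hfD' ih =>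
    rintro x y hxy (rfl | rfl | hx)
    · exact .inl ((M.isMax_of_dim_eq_two (M.dim_eq_two_of_lt he hf')).eq_of_le hxy).symm
    · rcases hxy.eq_or_lt with rfl | hxy
      · exact .inr (.inl rfl)
      · rcases (M.Ioi_eq_pair he hf hf' (ne_of_mem_of_not_mem hfD hfD')).le hxy with rfl | rfl
        · exact .inr (.inr hfD)
        · exact .inl rfl
    · exact .inr (.inr (ih hxy hx))

lemma isPreconnectedRegion (h : M.IsDisc D) : IsPreconnectedRegion D := by
  induction h with
  | face =>
    rintro _ rfl _ rfl
    exact .refl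
  | glue _ _ hf hf' hfD _ ih =>
    exact (ih.insert hfD (.inr hf.le)).insert (Set.mem_insert _ _) (.inl hf'.le)

lemma hasPotentials (h : M.IsDisc D) : HasPotentials G D := by
  induction h with
  | face => exact hasPotentials_singleton _
  | @glue D e f f' hD he hf hf' hfD hfD' ih =>
    have heD : e ∉ D := fun h => hfD' (hD.isUpperSet hf'.le h)
    refine (ih.insert heD ?_).insert ?_ ?_
    · refine isConnectedRegion_of_incident (x := f) ⟨hfD, .inr hf.le⟩ ?_
      rintro a ⟨ha, hae | hea⟩
      · exact absurd (hD.isUpperSet hae ha) heD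
      · have hea := hea.lt_of_ne (ne_of_mem_of_not_mem ha heD).symm
        rcases (M.Ioi_eq_pair he hf hf' (ne_of_mem_of_not_mem hfD hfD')).le hea with rfl | rfl
        · exact .refl _
        · exact absurd ha hfD'
    · rintro (rfl | h)
      · exact hf'.false
      · exact hfD' h
    · refine isConnectedRegion_of_incident (x := e) ⟨.inl rfl, .inl hf'.le⟩ ?_
      rintro a ⟨rfl | ha, haf | hfa⟩
      · exact .refl _
      · exact .refl _
      · exact absurd (hD.isUpperSet haf ha) hfD'
      · rw [← (M.isMax_of_dim_eq_two (M.dim_eq_two_of_lt he hf')).eq_of_le hfa]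
        exact .inl hf'.le

end IsDisc

lemma exists_isDisc_closed_off (hT : ∀ c ∈ T, M.dim c ≤ 1) (hf : M.dim f = 2) :
    ∃ D, M.IsDisc D ∧ D ⊆ Tᶜ ∧ f ∈ D ∧
      ∀ e, M.dim e = 1 → e ∉ T → ∀ f f', e < f → e < f' → f ∈ D → f' ∈ D := by
  have := M.finite
  have hface : ∀ f, M.dim f = 2 → f ∈ Tᶜ := fun f hf hfT => by
    have := hT f hfT
    omega
  obtain ⟨D, hfD, hD⟩ := Finite.exists_le_maximal (a := ({f} : Set C))
    (p := fun D => M.IsDisc D ∧ D ⊆ Tᶜ) ⟨.face hf, Set.singleton_subset_iff.2 (hface f hf)⟩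
  refine ⟨D, hD.prop.1, hD.prop.2, hfD rfl, fun e he heT f f' hf hf' hfD => ?_⟩
  by_contra hfD'
  have hle : insert f' (insert e D) ≤ D :=
    hD.le_of_ge ⟨hD.prop.1.glue he hf hf' hfD hfD', Set.insert_subset
      (hface f' (M.dim_eq_two_of_lt he hf')) (Set.insert_subset heT hD.prop.2)⟩
      ((Set.subset_insert _ _).trans (Set.subset_insert _ _))
  exact hfD' (hle (Set.mem_insert _ _))

namespace TreeGrowth

/-- A change of `p` across edges of the tree only would be a mod 2 cycle carried by the tree. -/
lemma face_induction {p : C → Prop} (h : M.TreeGrowth {o} T) (ho : M.dim o = 0)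
    (hc : IsPreconnectedRegion (Set.univ : Set C))
    (hp : ∀ e, M.dim e = 1 → e ∉ T → ∀ f f', e < f → e < f' → p f → p f')
    (hf : M.dim f = 2) (hf' : M.dim f' = 2) (hpf : p f) : p f' := by
  classical
  let g : C → ZMod 2 := fun f => if p f then 1 else 0
  have hoff : ∀ e, M.dim e = 1 → e ∉ T → M.boundary g e = 0 := by
    intro e he heT
    rw [M.boundary_edge_eq_zero_iff he]
    intro f f' hf hf'
    have : p f ↔ p f' := ⟨hp e he heT f f' hf hf', hp e he heT f' f hf' hf⟩
    simp only [g, this]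
  have hzero : ∀ e, M.dim e = 1 → M.boundary g e = 0 := fun e he =>
    h.eq_zero_of_boundary_eq_zero (M.isLowerSet_singleton ho)
      (fun v hv _ => M.boundary_boundary hv g) hoff e he (by rintro rfl; omega)
  have hgf := M.eq_of_boundary_eq_zero isUpperSet_univ hc (fun e _ => hzero e)
    (Set.mem_univ f) (Set.mem_univ f') hf hf'
  by_contra hpf'
  simp [g, hpf, hpf'] at hgf

/-- A filling of the fundamental cycle of an edge outside `D` is constant on the faces, hence has no
boundary at that edge. -/
lemma compl_subset_of_forall_face
    (hM : HasPotentials (Multiplicative (ZMod 2)) (Set.univ : Set C)) (h : M.TreeGrowth {o} T)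
    (hT : ∀ v, M.dim v = 0 → v ∈ T) (hDu : IsUpperSet D) (hDc : IsPreconnectedRegion D)
    (hDT : D ⊆ Tᶜ) (hDface : ∀ f, M.dim f = 2 → f ∈ D) : Tᶜ ⊆ D := by
  intro c hcT
  have hc := M.dim_le_two c
  interval_cases hdim : M.dim c
  · exact absurd (hT c hdim) hcT
  · by_contra hcD
    obtain ⟨ω, hωc, hωT, hω⟩ := h.exists_fundamental_cycle hT hdim hcT
    obtain ⟨g, hg⟩ := M.exists_boundary_eq hM hω
    have hgD : ∀ e ∈ D, M.dim e = 1 → M.boundary g e = 0 := fun e heD he =>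
      (hg e he).trans (hωT e (hDT heD) (ne_of_mem_of_not_mem heD hcD))
    have hgc : M.boundary g c = 0 := by
      rw [M.boundary_edge_eq_zero_iff hdim]
      intro f f' hf hf'
      have hf₂ := M.dim_eq_two_of_lt hdim hf
      have hf₂' := M.dim_eq_two_of_lt hdim hf'
      exact M.eq_of_boundary_eq_zero hDu hDc hgD (hDface f hf₂) (hDface f' hf₂') hf₂ hf₂'
    rw [hg c hdim, hωc] at hgc
    exact one_ne_zero hgc
  · exact hDface c hdim

lemma hasPotentials_compl_of_spanning
    (hM : HasPotentials (Multiplicative (ZMod 2)) (Set.univ : Set C))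
    (hc : IsPreconnectedRegion (Set.univ : Set C)) (ho : M.dim o = 0) (h : M.TreeGrowth {o} T)
    (hT : ∀ v, M.dim v = 0 → v ∈ T) : HasPotentials G Tᶜ := by
  obtain ⟨f₀, -, hf₀⟩ := M.exists_face_ge o
  have hT₁ : ∀ c ∈ T, M.dim c ≤ 1 := h.dim_le_one (by rintro _ rfl; omega)
  obtain ⟨D, hD, hDT, hf₀D, hcross⟩ := exists_isDisc_closed_off hT₁ hf₀
  have hDface : ∀ f, M.dim f = 2 → f ∈ D := fun f hf =>
    h.face_induction ho hc hcross hf₀ hf hf₀D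
  have hDcompl : D = Tᶜ :=
    hDT.antisymm (h.compl_subset_of_forall_face hM hT hD.isUpperSet hD.isPreconnectedRegion hDT
      hDface)
  exact hDcompl ▸ hD.hasPotentials

end TreeGrowth

end Discs

end ClosedSurface

namespace Partition

variable {C : Type*} [PartialOrder C] {M : ClosedSurface C} {P : Partition M} {T U : Set C}
  {c e f f' v : C} {G : Type*} [Group G]

lemma IsPatch.subset (hU : P.IsPatch U) : U ⊆ P.networkᶜ := by
  obtain ⟨x, hx, rfl⟩ := hU
  exact fun y hy => Linked.mem hy hx

lemma IsPatch.mem_of_incident (hU : P.IsPatch U) {a b : C} (ha : a ∈ U) (hb : b ∈ P.networkᶜ)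
    (hab : Incident a b) : b ∈ U := by
  have ha' := hU.subset ha
  obtain ⟨x, -, rfl⟩ := hU
  exact Linked.trans ha (Linked.single ha' hb hab)

lemma IsPatch.isUpperSet (hU : P.IsPatch U) : IsUpperSet U := fun _ _ hab ha =>
  hU.mem_of_incident ha (fun hb => hU.subset ha (P.isLowerSet hab hb)) (.inl hab)

lemma IsPatch.isConnectedRegion (hU : P.IsPatch U) : IsConnectedRegion U := by
  obtain ⟨x, -, hUx⟩ := id hU
  have hxU : x ∈ U := hUx.ge .refl
  refine isConnectedRegion_of_linked hxU fun y hy => ?_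
  refine (Linked.induction (p := fun z => z ∈ U ∧ Linked U x z) (hUx.le hy) ⟨hxU, .refl⟩ ?_).2
  rintro a - b hb hab ⟨haU, hxa⟩
  have hbU := hU.mem_of_incident haU hb hab
  exact ⟨hbU, hxa.trans (.single haU hbU hab)⟩

/-- The edges of the network off `T` have no end points in `Tᶜ`, so a cocycle extends by any values
over them. -/
lemma hasPotentials_compl_network_of_subset (hTP : T ⊆ P.network)
    (hT : ∀ v ∈ P.network, M.dim v = 0 → v ∈ T) (h : HasPotentials G Tᶜ) :
    HasPotentials G P.networkᶜ := by
  have hnetwork : ∀ a ∈ Tᶜ, ∀ b, a < b → b ∈ P.networkᶜ := by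
    intro a ha b hab hb
    have hdim := M.dim_strictMono hab
    have hb₁ := P.dim_le_one b hb
    exact ha (hT a (P.isLowerSet hab.le hb) (by omega))
  intro w hw
  obtain ⟨g, hg⟩ := h.exists_of_lt (w := w) <| by
    intro a ha b hb c _ hab hbc
    by_cases haP : a ∈ P.network
    · have he := M.dim_eq_one_of_lt_of_lt hab hbc
      exact absurd (hT a haP (M.dim_eq_zero_of_lt he hab)) ha
    · exact hw a haP b (hnetwork a ha b hab) c (hnetwork b hb c hbc) (.inl hab.le) (.inl hbc.le)
        (.inl (hab.trans hbc).le)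
  exact ⟨g, hw.mul_eq_of_lt fun a ha b hb =>
    hg a (fun h => ha (hTP h)) b fun h => hb (hTP h)⟩

lemma hasPotentials_compl_network (hM : IsSimplyConnected (Set.univ : Set C))
    (hP : IsPreconnectedRegion P.network) : HasPotentials G P.networkᶜ := by
  rcases P.network.eq_empty_or_nonempty with hempty | ⟨c, hc⟩
  · rw [hempty, Set.compl_empty]
    exact hM.hasPotentials
  obtain ⟨o, hoc, ho⟩ := M.exists_vertex_le c
  obtain ⟨T, hoT, hTP, hT⟩ := ClosedSurface.exists_spanning_treeGrowth
    (Set.singleton_subset_iff.2 (P.isLowerSet hoc hc)) P.isLowerSet hP (Set.mem_singleton o) ho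
  obtain ⟨T', hTT', -, hT'⟩ := ClosedSurface.exists_spanning_treeGrowth
    (Set.subset_univ T) isLowerSet_univ hM.1.2 (hoT.subset rfl) ho
  have hT'G : HasPotentials G T'ᶜ :=
    (hoT.trans hTT').hasPotentials_compl_of_spanning hM.hasPotentials hM.1.2 ho
      fun v hv => hT' v trivial hv
  have hT_lower : IsLowerSet T := hoT.isLowerSet (M.isLowerSet_singleton ho)
  exact hasPotentials_compl_network_of_subset hTP hT (hTT'.hasPotentials_compl hT_lower hT'G)

lemma IsPatch.hasPotentials (hU : P.IsPatch U) (h : HasPotentials G P.networkᶜ) :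
    HasPotentials G U := by
  classical
  intro w hw
  obtain ⟨g, hg⟩ := h (fun a b => if a ∈ U then w a b else 1) <| by
    intro a ha b hb c hc hab hbc hac
    by_cases haU : a ∈ U
    · have hbU := hU.mem_of_incident haU hb hab
      have hcU := hU.mem_of_incident haU hc hac
      simp only [haU, hbU, if_true, hw a haU b hbU c hcU hab hbc hac]
    · have hbU : b ∉ U := fun hbU => haU (hU.mem_of_incident hbU ha hab.symm)
      simp only [haU, hbU, if_false, mul_one]
  refine ⟨g, fun a ha b hb hab => ?_⟩
  simpa only [ha, if_true] using hg a (hU.subset ha) b (hU.subset hb) hab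

lemma subset_closedPatch : U ⊆ P.closedPatch U := fun c hc => ⟨c, hc, le_rfl⟩

lemma isLowerSet_patchBoundary : IsLowerSet (P.patchBoundary U) := fun _ _ hba ha => by
  obtain ⟨⟨d, hd, had⟩, haP⟩ := ha
  exact ⟨⟨d, hd, hba.trans had⟩, P.isLowerSet hba haP⟩

lemma dim_eq_one_of_mem_patchBoundary (he : e ∈ P.patchBoundary U) (hve : v < e) :
    M.dim e = 1 := by
  have hdim := M.dim_strictMono hve
  have he₁ := P.dim_le_one e he.2
  omega

lemma IsPatch.closedPatch_eq (hU : P.IsPatch U) :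
    P.closedPatch U = U ∪ {e ∈ P.patchBoundary U | M.dim e = 1} ∪
      {v ∈ P.patchBoundary U | M.dim v = 0} := by
  ext c
  constructor
  · intro hc
    by_cases hcP : c ∈ P.network
    · have := P.dim_le_one c hcP
      interval_cases h : M.dim c
      · exact .inr ⟨⟨hc, hcP⟩, h⟩
      · exact .inl (.inr ⟨⟨hc, hcP⟩, h⟩)
    · obtain ⟨d, hd, hcd⟩ := hc
      exact .inl (.inl (hU.mem_of_incident hd hcP (.inr hcd)))
  · rintro ((h | h) | h)
    · exact subset_closedPatch h
    · exact h.1.1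
    · exact h.1.1

lemma IsPatch.isConnectedRegion_closedPatch (hU : P.IsPatch U) :
    IsConnectedRegion (P.closedPatch U) := by
  obtain ⟨⟨x, hx⟩, hc⟩ := hU.isConnectedRegion
  refine isConnectedRegion_of_linked (subset_closedPatch hx) ?_
  rintro a ⟨d, hd, had⟩
  exact ((hc x hx d hd).mono subset_closedPatch).trans
    (.single (subset_closedPatch hd) ⟨d, hd, had⟩ (.inr had))

lemma IsPatch.exists_face_of_mem_patchBoundary (hU : P.IsPatch U) (hc : c ∈ P.patchBoundary U) :
    ∃ f ∈ U, c < f ∧ M.dim f = 2 := by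
  obtain ⟨⟨d, hd, hcd⟩, hcP⟩ := hc
  obtain ⟨f, hdf, hf⟩ := M.exists_face_ge d
  have hfU := hU.isUpperSet hdf hd
  exact ⟨f, hfU, (hcd.trans hdf).lt_of_ne (ne_of_mem_of_not_mem hcP (hU.subset hfU)), hf⟩

lemma HasSimpleBoundary.boundary_indicator (hB : P.HasSimpleBoundary U) (hv : M.dim v = 0) :
    M.boundary ((P.patchBoundary U).indicator 1) v = 0 := by
  classical
  simp only [M.boundary_apply, Set.indicator_apply, Pi.one_apply, Finset.sum_boole]
  by_cases hvB : v ∈ P.patchBoundary U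
  · have hedges : {e | e ∈ P.patchBoundary U ∧ v < e} =
        ((M.cofaces v).filter (· ∈ P.patchBoundary U) : Set C) := by
      ext e
      rw [Finset.mem_coe, Finset.mem_filter, M.mem_cofaces_vertex hv]
      exact ⟨fun h => ⟨⟨h.2, dim_eq_one_of_mem_patchBoundary h.1 h.2⟩, h.1⟩,
        fun h => ⟨h.2, h.1.1⟩⟩
    rw [← Set.ncard_coe_finset, ← hedges, hB v hvB hv]
    exact CharTwo.two_eq_zero
  · rw [Finset.filter_eq_empty_iff.2, Finset.card_empty, Nat.cast_zero]
    exact fun e he heB =>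
      hvB (isLowerSet_patchBoundary ((M.mem_cofaces_vertex hv).1 he).1.le heB)

/-- Otherwise a filling of the boundary of the patch, being constant on the patch, would have no
boundary at `e`. -/
lemma HasSimpleBoundary.face_unique (hB : P.HasSimpleBoundary U)
    (hM : HasPotentials (Multiplicative (ZMod 2)) (Set.univ : Set C)) (hU : P.IsPatch U)
    (heB : e ∈ P.patchBoundary U) (he : M.dim e = 1) (hf : e < f) (hf' : e < f') (hfU : f ∈ U)
    (hfU' : f' ∈ U) : f = f' := by
  by_contra hne
  obtain ⟨g, hg⟩ := M.exists_boundary_eq hM fun v hv => hB.boundary_indicator hv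
  have hgU : ∀ e ∈ U, M.dim e = 1 → M.boundary g e = 0 := fun e heU he => by
    rw [hg e he, Set.indicator_of_notMem fun h => hU.subset heU h.2]
  have hgf : g f = g f' := M.eq_of_boundary_eq_zero hU.isUpperSet hU.isConnectedRegion.2 hgU
    hfU hfU' (M.dim_eq_two_of_lt he hf) (M.dim_eq_two_of_lt he hf')
  have hge := hg e he
  rw [M.boundary_edge_eq_add he hf hf' hne, hgf, CharTwo.add_self_eq_zero,
    Set.indicator_of_mem heB] at hge
  exact zero_ne_one hge

lemma HasSimpleBoundary.isConnectedRegion_inter_star (hB : P.HasSimpleBoundary U)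
    (hM : HasPotentials (Multiplicative (ZMod 2)) (Set.univ : Set C)) (hU : P.IsPatch U)
    (hvB : v ∈ P.patchBoundary U) (hv : M.dim v = 0) : IsConnectedRegion (U ∩ Set.Ioi v) := by
  obtain ⟨e₁, e₂, -, hedges⟩ := Set.ncard_eq_two.1 (hB v hvB hv)
  obtain ⟨he₁B, hve₁⟩ := hedges.ge (Set.mem_insert e₁ _)
  have he₁ := dim_eq_one_of_mem_patchBoundary he₁B hve₁
  obtain ⟨f₀, hf₀U, hef₀, hf₀⟩ := hU.exists_face_of_mem_patchBoundary he₁B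
  have hvf₀ := hve₁.trans hef₀
  refine isConnectedRegion_of_linked ⟨hf₀U, hvf₀⟩ ?_
  rintro c ⟨hcU, hvc⟩
  obtain ⟨f, hcf, hf⟩ := M.exists_face_ge c
  have hfU := hU.isUpperSet hcf hcU
  have hvf : v < f := hvc.trans_le hcf
  refine Linked.trans ?_ (Linked.single ⟨hfU, hvf⟩ ⟨hcU, hvc⟩ (.inr hcf))
  refine M.star_face_induction_of_ne (e₀ := e₂)
    (p := fun f => f ∈ U → Linked (U ∩ Set.Ioi v) f₀ f) hv ?_ hvf₀ hvf hf₀ hf (fun _ => .refl) hfU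
  intro e hve _ hne x y hx hy hlinked hyU
  by_cases heP : e ∈ P.network
  · obtain rfl : e = e₁ :=
      (hedges.le ⟨⟨⟨y, hyU, hy.le⟩, heP⟩, hve⟩).resolve_right hne
    rw [hB.face_unique hM hU he₁B he₁ hy hef₀ hyU hf₀U]
    exact .refl
  · have heU := hU.mem_of_incident hyU heP (.inr hy.le)
    have hxU := hU.isUpperSet hx.le heU
    exact ((hlinked hxU).trans (.single ⟨hxU, hve.trans hx⟩ ⟨heU, hve⟩ (.inr hx.le))).trans
      (.single ⟨heU, hve⟩ ⟨hyU, hve.trans hy⟩ (.inl hy.le))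

lemma HasSimpleBoundary.isConnectedRegion_link_vertex (hB : P.HasSimpleBoundary U)
    (hM : HasPotentials (Multiplicative (ZMod 2)) (Set.univ : Set C)) (hU : P.IsPatch U)
    (hvB : v ∈ P.patchBoundary U) (hv : M.dim v = 0) :
    IsConnectedRegion (link (U ∪ {e ∈ P.patchBoundary U | M.dim e = 1}) v) := by
  set S := U ∪ {e ∈ P.patchBoundary U | M.dim e = 1}
  obtain ⟨⟨x, hx⟩, hconn⟩ := hB.isConnectedRegion_inter_star hM hU hvB hv
  have hsub : U ∩ Set.Ioi v ⊆ link S v := fun a ha => ⟨.inl ha.1, .inr ha.2.le⟩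
  refine isConnectedRegion_of_linked (hsub hx) ?_
  rintro a ⟨haS, hav⟩
  have hne : a ≠ v := by
    rintro rfl
    exact haS.elim (fun h => hU.subset h hvB.2) fun h => by have := h.2; omega
  have hva : v < a := (hav.resolve_left fun h =>
    hne ((M.isMin_of_dim_eq_zero hv).eq_of_le h)).lt_of_ne hne.symm
  rcases haS with haU | ⟨haB, ha⟩
  · exact (hconn x hx a ⟨haU, hva⟩).mono hsub
  · obtain ⟨f, hfU, haf, -⟩ := hU.exists_face_of_mem_patchBoundary haB
    have hf : f ∈ U ∩ Set.Ioi v := ⟨hfU, hva.trans haf⟩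
    exact ((hconn x hx f hf).mono hsub).trans
      (.single (hsub hf) ⟨.inr ⟨haB, ha⟩, hav⟩ (.inr haf.le))

lemma HasSimpleBoundary.isConnectedRegion_link_edge (hB : P.HasSimpleBoundary U)
    (hM : HasPotentials (Multiplicative (ZMod 2)) (Set.univ : Set C)) (hU : P.IsPatch U)
    (heB : e ∈ P.patchBoundary U) (he : M.dim e = 1) : IsConnectedRegion (link U e) := by
  obtain ⟨f, hfU, hef, -⟩ := hU.exists_face_of_mem_patchBoundary heB
  refine isConnectedRegion_of_incident (x := f) ⟨hfU, .inr hef.le⟩ ?_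
  rintro a ⟨haU, hae | hea⟩
  · exact absurd (P.isLowerSet hae heB.2) (hU.subset haU)
  · have hea := hea.lt_of_ne (ne_of_mem_of_not_mem heB.2 (hU.subset haU))
    exact .inl (hB.face_unique hM hU heB he hef hea hfU haU).le

lemma HasSimpleBoundary.hasPotentials_closedPatch (hB : P.HasSimpleBoundary U)
    (hM : HasPotentials (Multiplicative (ZMod 2)) (Set.univ : Set C)) (hU : P.IsPatch U)
    (h : HasPotentials G U) : HasPotentials G (P.closedPatch U) := by
  rw [hU.closedPatch_eq]
  refine (h.union (M.isAntichain_dim_eq.subset fun _ => And.right) ?_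
    fun e he => hB.isConnectedRegion_link_edge hM hU he.1 he.2).union
    (M.isAntichain_dim_eq.subset fun _ => And.right) ?_
    fun v hv => hB.isConnectedRegion_link_vertex hM hU hv.1 hv.2
  · exact Set.disjoint_left.2 fun x hxU hx => hU.subset hxU hx.1.2
  · rw [Set.disjoint_left]
    rintro x (hxU | hxB) hx
    · exact hU.subset hxU hx.1.2
    · exact one_ne_zero (hxB.2.symm.trans hx.2)

end Partition

end DiscreteSurface

theorem lemma3p1 {C : Type*} [PartialOrder C] (M : DiscreteSurface.ClosedSurface C)
    (hM : DiscreteSurface.IsSimplyConnected (Set.univ : Set C))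
    (P : DiscreteSurface.Partition M)
    (hP : DiscreteSurface.IsPreconnectedRegion P.network)
    (U : Set C) (hU : P.IsPatch U) :
    DiscreteSurface.IsSimplyConnected U ∧
      (P.HasSimpleBoundary U → DiscreteSurface.IsSimplyConnected (P.closedPatch U)) := by
  have hG := fun (G : Type _) [Group G] =>
    hU.hasPotentials (DiscreteSurface.Partition.hasPotentials_compl_network (G := G) hM hP)
  exact ⟨DiscreteSurface.isSimplyConnected_of_hasPotentials hU.isConnectedRegion fun _ => hG _,
    fun hB => DiscreteSurface.isSimplyConnected_of_hasPotentials hU.isConnectedRegion_closedPatch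
      fun _ => hB.hasPotentials_closedPatch hM.hasPotentials hU (hG _)⟩
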